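/- Let $G$ be a compact group. Fix a set $\mathcal R$ of irreducible unitary continuous representations of $G$ containing exactly one from each (unitary) equivalence class; elements of $\mathcal R$ are called labels. For $a\in\mathcal R$ let $a^*\in\mathcal R$ be the label equivalent to the dual of $a$, and fix a unitary equivalence of $a^*$ with the dual representation of $a$. Let $J_a\colon a\to a^*$ be the resulting antiunitary map, sending $x$ to the vector that corresponds to the functional $\langle x,\cdot\rangle$. Let $M$ be a compact oriented $(d+1)$-manifold and $S\subseteq M$ a compact oriented $d$-dimensional submanifold, both without boundary, $d\ge 0$. Let $\Theta$ be a (finite) triangulation of $M$ that restricts to a triangulation $\Delta$ of $S$. In the dual complex of a triangulated $m$-manifold there is one $k$-cell for each $(m-k)$-simplex. Orient the 1- and 2-cells of the dual complex $\Theta^*$ and the 1-cells of the dual complex $\Delta^*$ arbitrarily. A spin network in $S$ is a labeling of each edge $e$ of the 1-skeleton $\gamma$ of $\Delta^*$ by some $\rho_e\in\mathcal R$, together with, for each vertex $v$, a $G$-intertwiner $\iota_v\colon\bigotimes_{e\text{ into }v}\rho_e\to\bigotimes_{e\text{ out of }v}\rho_e$. A closed spin foam in $M$ is a labeling of each face $f$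 of the 2-skeleton $\kappa$ of $\Theta^*$ by some $\tilde\rho_f\in\mathcal R$, together with, for each edge $\epsilon$, a $G$-intertwiner $\tilde\iota_\epsilon\colon\bigotimes_{f\text{ incoming to }\epsilon}\tilde\rho_f\to\bigotimes_{f\text{ outgoing from }\epsilon}\tilde\rho_f$. Here a face $f$ having $\epsilon$ as a side is incoming to $\epsilon$ if the orientation of $\epsilon$ agrees with the direction in which the boundary of $f$ is traversed, and outgoing otherwise. Each $k$-cell $X$ of $\Delta^*$ lies in a unique $(k+1)$-cell $\tilde X$ of $\Theta^*$, the one dual to the same simplex. The orientations of $S$ and $M$ orient the normal bundle of $S$, and those of $X$ and $\tilde X$ orient the normal bundle of the interior of $X$ in $\tilde X$ (in both cases by the rule: tangent frame first, normal vector last; 0-cells are positively oriented). Call $\tilde X$ incoming to $X$ if these two normal orientations agree along $X$, and outgoing otherwise. **Proposition.** For every closed spin foam $F=(\kappa,\tilde\rho,\tilde\iota)$ in $M$ there is a unique spin network $F|_S=(\gamma,\rho,\iota)$ in $S$ such that: 1. $\gamma$ is the 1-skeleton of $\Delta^*$ (with its chosen orientation); 2. for every edge $e$ of $\gamma$, $\tilde\rho_{\tilde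 e}=\rho_e$ if $\tilde e$ is incoming to $e$, and $\tilde\rho_{\tilde e}=(\rho_e)^*$ if $\tilde e$ is outgoing; 3. for every vertex $v$ of $\gamma$, $\tilde\iota_{\tilde v}$ equals $\iota_v$ after dualization. Explicitly, given vectors $x_e\in\rho_e$ for the edges $e$ of $\gamma$, put $y_{\tilde e}=x_e$ if $\tilde e$ is incoming to $e$ and $y_{\tilde e}=J_{\rho_e}x_e$ if it is outgoing. Then, for all such vectors, the matrix coefficient $$\Big\langle \bigotimes_{f\text{ outgoing from }\tilde v}y_f,\ \tilde\iota_{\tilde v}\bigotimes_{f\text{ incoming to }\tilde v}y_f\Big\rangle$$ equals $$\Big\langle\bigotimes_{e\text{ out of }v}x_e,\ \iota_v\bigotimes_{e\text{ into }v}x_e\Big\rangle$$ if $\tilde v$ is incoming to $v$, and equals the complex conjugate of the latter (that is, the corresponding coefficient of the Hermitian adjoint of $\iota_v$) if $\tilde v$ is outgoing. -/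

import Mathlib

open scoped TensorProduct

universe u

noncomputable section

namespace SpinFoam

/-! ## Irreducible unitary representations, duals, intertwiners -/

section Representations

variable (G : Type*) [Group G] [TopologicalSpace G]

/-- An irreducible unitary (strongly) continuous representation of `G` on a finite-dimensional
complex Hilbert space.  For compact `G`, finite-dimensionality is automatic. -/
structure UnitaryIrrep where
  V : Type u
  [normed : NormedAddCommGroup V]
  [innerProd : InnerProductSpace ℂ V]
  [finiteDim : FiniteDimensional ℂ V]
  rep : Representation ℂ G V
  norm_rep : ∀ g x, ‖rep g x‖ = ‖x‖
  continuous_rep : ∀ x, Continuous fun g => rep g x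
  irreducible : rep.IsIrreducible

attribute [instance] UnitaryIrrep.normed UnitaryIrrep.innerProd UnitaryIrrep.finiteDim

variable {G}

/-- A unitary equivalence of representations. -/
structure UnitaryEquiv (π σ : UnitaryIrrep.{u} G) where
  toIsometry : π.V ≃ₗᵢ[ℂ] σ.V
  map_rep : ∀ g x, toIsometry (π.rep g x) = σ.rep g (toIsometry x)

/-- The dual Hilbert space, with the inner product transported along the (conjugate-linear)
Riesz isometry `x ↦ ⟪x, ·⟫`.  Its norm is the operator norm. -/
@[reducible] def dualInnerProductSpace (V : Type u) [NormedAddCommGroup V]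
    [InnerProductSpace ℂ V] [CompleteSpace V] : InnerProductSpace ℂ (StrongDual ℂ V) where
  inner ξ η := inner ℂ ((InnerProductSpace.toDual ℂ V).symm η)
    ((InnerProductSpace.toDual ℂ V).symm ξ)
  norm_sq_eq_re_inner ξ := by
    rw [← (InnerProductSpace.toDual ℂ V).symm.norm_map ξ]
    exact norm_sq_eq_re_inner _
  conj_inner_symm ξ η := inner_conj_symm _ _
  add_left ξ η ζ := by rw [map_add, inner_add_right]
  smul_left ξ η c := by rw [LinearIsometryEquiv.map_smulₛₗ, inner_smul_right]

/-- The contragredient action on the dual space: `(g • ξ) x = ξ (g⁻¹ • x)`. -/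
def dualRep (π : UnitaryIrrep.{u} G) : Representation ℂ G (StrongDual ℂ π.V) where
  toFun g :=
    { toFun := fun ξ => ξ ∘L (LinearMap.toContinuousLinearMap (π.rep g⁻¹))
      map_add' := fun _ _ => rfl
      map_smul' := fun _ _ => rfl }
  map_one' := by ext ξ x; simp
  map_mul' g h := by ext ξ x; simp only [mul_inv_rev, map_mul]; rfl

theorem inner_rep (π : UnitaryIrrep.{u} G) (g : G) (x y : π.V) :
    inner ℂ (π.rep g x) (π.rep g y) = inner ℂ x y :=
  (⟨π.rep g, π.norm_rep g⟩ : π.V →ₗᵢ[ℂ] π.V).inner_map_map x y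

theorem dualRep_riesz (π : UnitaryIrrep.{u} G) (g : G) (x : π.V) :
    dualRep π g (innerSL ℂ x) = innerSL ℂ (π.rep g x) := by
  ext y
  have h := inner_rep π g x (π.rep g⁻¹ y)
  rw [← Module.End.mul_apply, ← map_mul, mul_inv_cancel, map_one] at h
  exact h.symm

theorem exists_riesz (π : UnitaryIrrep.{u} G) (ξ : StrongDual ℂ π.V) :
    ∃ x, innerSL ℂ x = ξ := by
  have := FiniteDimensional.complete ℂ π.V
  exact ⟨(InnerProductSpace.toDual ℂ π.V).symm ξ,
    (InnerProductSpace.toDual ℂ π.V).apply_symm_apply ξ⟩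

theorem dualRep_irreducible (π : UnitaryIrrep.{u} G) : (dualRep π).IsIrreducible := by
  have := FiniteDimensional.complete ℂ π.V
  have := π.irreducible
  let D := InnerProductSpace.toDual ℂ π.V
  have hD : ∀ x, D x = innerSL ℂ x := fun _ => rfl
  have back : ∀ W : Subrepresentation (dualRep π), ∃ U : Subrepresentation π.rep,
      ∀ x, x ∈ U ↔ D x ∈ W := fun W =>
    ⟨{ toSubmodule := W.toSubmodule.comap D.toLinearEquiv.toLinearMap
       apply_mem_toSubmodule := fun g x hx => by
        have := W.apply_mem_toSubmodule g (v := D x) hx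
        rw [hD, dualRep_riesz] at this
        exact this }, fun _ => Iff.rfl⟩
  obtain ⟨⟨A, B, hAB⟩⟩ := (inferInstance : Nontrivial (Subrepresentation π.rep))
  have hV : ∃ x : π.V, x ≠ 0 := by
    by_contra! h
    refine hAB (SetLike.ext fun x => ?_)
    rw [h x]
    exact ⟨fun _ => B.toSubmodule.zero_mem, fun _ => A.toSubmodule.zero_mem⟩
  obtain ⟨x₀, hx₀⟩ := hV
  refine { exists_pair_ne := ⟨⊥, ⊤, fun h => hx₀ ?_⟩, eq_bot_or_eq_top := fun W => ?_ }
  · have : D x₀ ∈ (⊥ : Subrepresentation (dualRep π)) := h ▸ (Submodule.mem_top : D x₀ ∈ _)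
    have h0 : D x₀ = 0 := this
    simpa using h0
  · obtain ⟨U, hU⟩ := back W
    rcases eq_bot_or_eq_top U with h | h
    · left
      refine SetLike.ext fun ξ => ?_
      have h1 := hU (D.symm ξ)
      rw [h, D.apply_symm_apply] at h1
      refine h1.symm.trans ?_
      change D.symm ξ = 0 ↔ ξ = 0
      simp
    · right
      refine SetLike.ext fun ξ => ?_
      have h1 := hU (D.symm ξ)
      rw [h, D.apply_symm_apply] at h1
      exact h1.symm.trans ⟨fun _ => Submodule.mem_top, fun _ => Submodule.mem_top⟩

/-- The dual of an irreducible unitary representation. -/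
def UnitaryIrrep.dual (π : UnitaryIrrep.{u} G) : UnitaryIrrep.{u} G :=
  haveI := FiniteDimensional.complete ℂ π.V
  { V := StrongDual ℂ π.V
    normed := inferInstance
    innerProd := dualInnerProductSpace π.V
    finiteDim := inferInstance
    rep := dualRep π
    norm_rep := fun g ξ => by
      obtain ⟨x, rfl⟩ := exists_riesz π ξ
      rw [dualRep_riesz, innerSL_apply_norm, innerSL_apply_norm, π.norm_rep]
    continuous_rep := fun ξ => by
      obtain ⟨x, rfl⟩ := exists_riesz π ξ
      simp only [dualRep_riesz]
      exact (innerSL ℂ).continuous.comp (π.continuous_rep x)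
    irreducible := dualRep_irreducible π }

variable (G) in
/-- A set of irreducible unitary representations, one from each equivalence class.
Labels are elements of this set. -/
structure IrrepSystem where
  carrier : Set (UnitaryIrrep.{u} G)
  existsUnique_equiv : ∀ π : UnitaryIrrep.{u} G,
    ∃! σ, σ ∈ carrier ∧ Nonempty (UnitaryEquiv σ π)

/-- The labels. -/
abbrev IrrepSystem.Label (R : IrrepSystem.{u} G) : Type _ := R.carrier

/-- The dual `a*` of a label: the unique label equivalent to the dual representation of `a`. -/
def IrrepSystem.dual (R : IrrepSystem.{u} G) (a : R.Label) : R.Label :=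
  ⟨(R.existsUnique_equiv a.1.dual).choose, (R.existsUnique_equiv a.1.dual).choose_spec.1.1⟩

/-- A choice, for each label `a`, of a unitary equivalence from the representation labelled `a*`
to the dual of the representation labelled `a`. -/
def IrrepSystem.DualIdentification (R : IrrepSystem.{u} G) : Type _ :=
  ∀ a : R.Label, UnitaryEquiv (R.dual a).1 a.1.dual

/-- A vector in one of the label representations, together with its label. -/
abbrev IrrepSystem.Vec (R : IrrepSystem.{u} G) : Type _ := Σ a : R.Label, a.1.V

/-- The antiunitary map from the representation `a` to the representation `a*` that sends `x` to
the vector corresponding to the functional `⟪x, ·⟫`. -/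
def IrrepSystem.dualVec {R : IrrepSystem.{u} G} (φ : R.DualIdentification) (x : R.Vec) : R.Vec :=
  ⟨R.dual x.1, (φ x.1).toIsometry.symm (innerSL ℂ x.2 : StrongDual ℂ x.1.1.V)⟩

/-- The tensor product of the representations labelled `a i`, `i ∈ I`. -/
def tensorRep {R : IrrepSystem.{u} G} {I : Type*} (a : I → R.Label) :
    Representation ℂ G (⨂[ℂ] i, (a i).1.V) where
  toFun g := PiTensorProduct.map fun i => (a i).1.rep g
  map_one' := by simp only [map_one]; exact PiTensorProduct.map_one
  map_mul' g h := by simp only [map_mul]; exact PiTensorProduct.map_mul _ _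

/-- Intertwiners `⨂ i, a i → ⨂ j, b j`. -/
abbrev Intertwiner {R : IrrepSystem.{u} G} {I J : Type*} (a : I → R.Label) (b : J → R.Label) :=
  Representation.IntertwiningMap (tensorRep a) (tensorRep b)

/-- The matrix coefficient `⟪⨂ j, y j, T (⨂ i, x i)⟫` of an intertwiner `T`. -/
def Intertwiner.coeff {R : IrrepSystem.{u} G} {I J : Type*} [Finite J]
    {a : I → R.Label} {b : J → R.Label} (T : Intertwiner a b)
    (x : ∀ i, (a i).1.V) (y : ∀ j, (b j).1.V) : ℂ :=
  PiTensorProduct.dualDistrib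
    (⨂ₜ[ℂ] j, (innerSL ℂ (y j) : StrongDual ℂ (b j).1.V).toLinearMap) (T (⨂ₜ[ℂ] i, x i))

end Representations

/-! ## Oriented complexes, spin networks, closed spin foams -/

/-- The combinatorial data of a finite oriented 1-dimensional complex: vertices, oriented edges,
source and target; the endpoints of an edge are distinct. -/
structure OrientedGraph where
  Vertex : Type
  Edge : Type
  [finite_vertex : Finite Vertex]
  [finite_edge : Finite Edge]
  src : Edge → Vertex
  tgt : Edge → Vertex
  src_ne_tgt : ∀ e, src e ≠ tgt e

attribute [instance] OrientedGraph.finite_vertex OrientedGraph.finite_edge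

/-- The combinatorial data of a finite oriented 2-dimensional complex.  Each face `f` is a polygon
with at least three sides.  Its orientation is a cyclic enumeration `corner f i`, `side f i` of
its vertices and edges, where `side f i` joins `corner f i` to `corner f (i + 1)`. -/
structure OrientedTwoComplex extends OrientedGraph where
  Face : Type
  [finite_face : Finite Face]
  sides : Face → ℕ
  three_le_sides : ∀ f, 3 ≤ sides f
  side : ∀ f, ZMod (sides f) → Edge
  corner : ∀ f, ZMod (sides f) → Vertex
  side_injective : ∀ f, Function.Injective (side f)
  side_ends : ∀ f i,
    (src (side f i) = corner f i ∧ tgt (side f i) = corner f (i + 1)) ∨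
    (tgt (side f i) = corner f i ∧ src (side f i) = corner f (i + 1))

attribute [instance] OrientedTwoComplex.finite_face

/-- `f` is incoming to `e`: `e` is a side of `f` whose orientation agrees with that of `f`. -/
def OrientedTwoComplex.Incoming (κ : OrientedTwoComplex) (f : κ.Face) (e : κ.Edge) : Prop :=
  ∃ i, κ.side f i = e ∧ κ.src e = κ.corner f i ∧ κ.tgt e = κ.corner f (i + 1)

/-- `f` is outgoing from `e`: `e` is a side of `f` whose orientation disagrees with that of `f`. -/
def OrientedTwoComplex.Outgoing (κ : OrientedTwoComplex) (f : κ.Face) (e : κ.Edge) : Prop :=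
  ∃ i, κ.side f i = e ∧ κ.tgt e = κ.corner f i ∧ κ.src e = κ.corner f (i + 1)

section Networks

variable {G : Type*} [Group G] [TopologicalSpace G]

/-- A spin network with underlying oriented 1-dimensional complex `γ`: labels on the edges, and at
each vertex an intertwiner from the tensor product over the incoming edges to the tensor product
over the outgoing edges. -/
structure SpinNetwork (R : IrrepSystem.{u} G) (γ : OrientedGraph) where
  label : γ.Edge → R.Label
  intertwiner : ∀ v, Intertwiner (fun e : {e // γ.tgt e = v} => label e)
    (fun e : {e // γ.src e = v} => label e)

/-- A closed spin foam with underlying oriented 2-dimensional complex `κ`: labels on the faces, and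
at each edge an intertwiner from the tensor product over the incoming faces to the tensor product
over the outgoing faces. -/
structure ClosedSpinFoam (R : IrrepSystem.{u} G) (κ : OrientedTwoComplex) where
  label : κ.Face → R.Label
  intertwiner : ∀ e, Intertwiner (fun f : {f // κ.Incoming f e} => label f)
    (fun f : {f // κ.Outgoing f e} => label f)

end Networks

/-! ## Triangulated oriented manifolds and their dual complexes -/

/-- Euclidean space, in which the simplicial complexes live. -/
abbrev Space (N : ℕ) : Type := EuclideanSpace ℝ (Fin N)

/-- A finite triangulation of the topological space `M`. -/
structure Triangulation (N : ℕ) (M : Type*) [TopologicalSpace M] where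
  complex : Geometry.SimplicialComplex ℝ (Space N)
  finite_faces : complex.faces.Finite
  homeo : complex.space ≃ₜ M

/-- The triangulation `Θ` of `M` restricts to the triangulation `Δ` of the subspace `S`. -/
structure Triangulation.RestrictsTo {N : ℕ} {M : Type*} [TopologicalSpace M]
    (Θ : Triangulation N M) {S : Set M} (Δ : Triangulation N S) : Prop where
  faces_subset : Δ.complex.faces ⊆ Θ.complex.faces
  homeo_eq : ∀ x (h : x ∈ Δ.complex.space) (h' : x ∈ Θ.complex.space),
    (Δ.homeo ⟨x, h⟩ : M) = Θ.homeo ⟨x, h'⟩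

section Dual

variable {N : ℕ} {M : Type*} [TopologicalSpace M]

/-- The simplices of the triangulation with `k` vertices (that is, of dimension `k - 1`; there
are none for `k = 0`). -/
abbrev Triangulation.Simplex (Θ : Triangulation N M) (k : ℕ) : Type :=
  {σ : Finset (Space N) // σ ∈ Θ.complex.faces ∧ σ.card = k}

theorem Triangulation.finite_simplex (Θ : Triangulation N M) (k : ℕ) : Finite (Θ.Simplex k) :=
  Set.Finite.to_subtype (s := {σ | σ ∈ Θ.complex.faces ∧ σ.card = k})
    (Θ.finite_faces.subset fun _ h => h.1)

/-- `p` is an ordering of the vertices of `σ`. -/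
def IsOrdering {k : ℕ} (p : Fin k → Space N) (σ : Finset (Space N)) : Prop :=
  Function.Injective p ∧ Set.range p = σ

/-- An orientation of a triangulated `m`-manifold: each `m`-simplex is oriented (a sign for each
ordering of its vertices, alternating under permutations), such that two distinct `m`-simplices
with a common `(m - 1)`-face induce opposite orientations on it. -/
structure Triangulation.Orientation (Θ : Triangulation N M) (m : ℕ) where
  sign : (Fin (m + 1) → Space N) → ℤˣ
  sign_perm : ∀ (σ : Θ.Simplex (m + 1)) (p : Fin (m + 1) → Space N), IsOrdering p σ.1 →
    ∀ π : Equiv.Perm (Fin (m + 1)), sign (p ∘ π) = Equiv.Perm.sign π * sign p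
  coherent : ∀ (α : Θ.Simplex m) (σ τ : Θ.Simplex (m + 1)) (q : Fin m → Space N) (a b : Space N),
    σ ≠ τ → IsOrdering q α.1 →
    IsOrdering (Fin.snoc (α := fun _ => Space N) q a) σ.1 →
    IsOrdering (Fin.snoc (α := fun _ => Space N) q b) τ.1 →
    sign (Fin.snoc (α := fun _ => Space N) q a) = - sign (Fin.snoc (α := fun _ => Space N) q b)

/-- The dual complex of a triangulated `m`-manifold has one `k`-cell for each `(m - k)`-simplex.
An orientation of its 1-cells: the 1-cell dual to an `(m - 1)`-simplex `σ` joins the 0-cells dual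
to the two `m`-simplices containing `σ`; one of them is its source and the other its target. -/
structure Triangulation.DualOrientation₁ (Θ : Triangulation N M) (m : ℕ) where
  src : Θ.Simplex m → Θ.Simplex (m + 1)
  tgt : Θ.Simplex m → Θ.Simplex (m + 1)
  src_ne_tgt : ∀ σ, src σ ≠ tgt σ
  subset_iff : ∀ (σ : Θ.Simplex m) (τ : Θ.Simplex (m + 1)),
    σ.1 ⊆ τ.1 ↔ τ = src σ ∨ τ = tgt σ

/-- The 1-skeleton of the dual complex of a triangulated `m`-manifold, with oriented edges. -/
def Triangulation.DualOrientation₁.skeleton {Θ : Triangulation N M} {m : ℕ}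
    (o : Θ.DualOrientation₁ m) : OrientedGraph where
  Vertex := Θ.Simplex (m + 1)
  Edge := Θ.Simplex m
  finite_vertex := Θ.finite_simplex _
  finite_edge := Θ.finite_simplex _
  src := o.src
  tgt := o.tgt
  src_ne_tgt := o.src_ne_tgt

/-- An orientation of the 1-cells and 2-cells of the dual complex of a triangulated
`(m + 1)`-manifold.  The 2-cell dual to an `(m - 1)`-simplex `α` is the polygon whose corners are
dual to the `(m + 1)`-simplices containing `α` and whose sides are dual to the `m`-simplices
containing `α`.  Its orientation is given by enumerating these in cyclic order. -/
structure Triangulation.DualOrientation₂ (Θ : Triangulation N M) (m : ℕ)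
    extends Θ.DualOrientation₁ (m + 1) where
  sides : Θ.Simplex m → ℕ
  three_le_sides : ∀ α, 3 ≤ sides α
  side : ∀ α, ZMod (sides α) → Θ.Simplex (m + 1)
  corner : ∀ α, ZMod (sides α) → Θ.Simplex (m + 2)
  side_injective : ∀ α, Function.Injective (side α)
  corner_injective : ∀ α, Function.Injective (corner α)
  subset_iff_side : ∀ (α : Θ.Simplex m) (σ : Θ.Simplex (m + 1)),
    α.1 ⊆ σ.1 ↔ ∃ i, side α i = σ
  subset_iff_corner : ∀ (α : Θ.Simplex m) (τ : Θ.Simplex (m + 2)),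
    α.1 ⊆ τ.1 ↔ ∃ i, corner α i = τ
  side_subset_corner : ∀ α i, (side α i).1 ⊆ (corner α i).1
  side_subset_corner_succ : ∀ α i, (side α i).1 ⊆ (corner α (i + 1)).1

/-- The 2-skeleton of the dual complex of a triangulated `(m + 1)`-manifold, with oriented edges
and faces. -/
def Triangulation.DualOrientation₂.skeleton {Θ : Triangulation N M} {m : ℕ}
    (o : Θ.DualOrientation₂ m) : OrientedTwoComplex where
  toOrientedGraph := o.toDualOrientation₁.skeleton
  Face := Θ.Simplex m
  finite_face := Θ.finite_simplex _
  sides := o.sides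
  three_le_sides := o.three_le_sides
  side := o.side
  corner := o.corner
  side_injective := o.side_injective
  side_ends α i := by
    have h1 := (o.subset_iff _ _).1 (o.side_subset_corner α i)
    have h2 := (o.subset_iff _ _).1 (o.side_subset_corner_succ α i)
    have hne : o.corner α i ≠ o.corner α (i + 1) := fun h => by
      have h3 := o.corner_injective α h
      have h4 : (1 : ZMod (o.sides α)) = 0 := by simpa using h3.symm
      have : Fact (1 < o.sides α) := ⟨by have := o.three_le_sides α; omega⟩
      exact one_ne_zero h4
    change (o.src _ = _ ∧ o.tgt _ = _) ∨ (o.tgt _ = _ ∧ o.src _ = _)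
    rcases h1 with h1 | h1 <;> rcases h2 with h2 | h2
    · exact absurd (h1.trans h2.symm) hne
    · exact Or.inl ⟨h1.symm, h2.symm⟩
    · exact Or.inr ⟨h1.symm, h2.symm⟩
    · exact absurd (h1.trans h2.symm) hne

end Dual

/-! ## Restriction of a closed spin foam to a hypersurface -/

section Restriction

variable {N d : ℕ} {M : Type*} [TopologicalSpace M] {S : Set M}
  {Θ : Triangulation N M} {Δ : Triangulation N S}

/-- Each `k`-cell `X` of the dual complex of `S` lies in a unique `(k + 1)`-cell `X̃` of the dual
complex of `M`, namely the cell dual to the same simplex.  In terms of simplices, the map `X ↦ X̃`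
is therefore the inclusion. -/
def tilde (h : Θ.RestrictsTo Δ) {k : ℕ} (σ : Δ.Simplex k) : Θ.Simplex k :=
  ⟨σ.1, h.faces_subset σ.2.1, σ.2.2⟩

/-- The `(d + 1)`-simplex `τ` of `M` lies on the positive side of the `d`-simplex `σ` of `S`, with
respect to the orientation of the normal bundle of `S` for which an oriented frame of `S` followed
by a positive normal vector is an oriented frame of `M`. -/
def PositiveSide (oM : Θ.Orientation (d + 1)) (oS : Δ.Orientation d)
    (σ : Δ.Simplex (d + 1)) (τ : Θ.Simplex (d + 2)) : Prop :=
  ∃ (p : Fin (d + 1) → Space N) (b : Space N), IsOrdering p σ.1 ∧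
    IsOrdering (Fin.snoc (α := fun _ => Space N) p b) τ.1 ∧
    oS.sign p * oM.sign (Fin.snoc (α := fun _ => Space N) p b) = 1

/-- The edge `ṽ` of the dual complex of `M` is incoming to the vertex `v` of the dual complex of
`S`: it crosses `S` at `v` in the direction of the positive normal. -/
def IncomingAtVertex (h : Θ.RestrictsTo Δ) (oM : Θ.Orientation (d + 1)) (oS : Δ.Orientation d)
    (κ : Θ.DualOrientation₂ d) (v : Δ.Simplex (d + 1)) : Prop :=
  PositiveSide oM oS v (κ.tgt (tilde h v))

/-- The face `ẽ` of the dual complex of `M` is incoming to the edge `e` of the dual complex of `S`: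
the normal direction of `e` in `ẽ` which together with `e` (`e` first, the normal second) gives the
orientation of `ẽ` is the positive normal direction of `S`.  Equivalently, running around the
boundary of `ẽ` in the direction of its orientation, one crosses `S` at the target of `e` in the
direction of the positive normal. -/
def IncomingAtEdge (h : Θ.RestrictsTo Δ) (oM : Θ.Orientation (d + 1)) (oS : Δ.Orientation d)
    (κ : Θ.DualOrientation₂ d) (γ : Δ.DualOrientation₁ d) (e : Δ.Simplex d) : Prop :=
  ∃ i, κ.side (tilde h e) i = tilde h (γ.tgt e) ∧
    PositiveSide oM oS (γ.tgt e) (κ.corner (tilde h e) (i + 1))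

variable {G : Type*} [Group G] [TopologicalSpace G] {R : IrrepSystem.{u} G}

/-- The vectors `x e` at the edges of the dual complex of `S` and `y f` at the faces of the dual
complex of `M` correspond to each other: `y ẽ` is `x e` if `ẽ` is incoming to `e`, and it is the
dual vector of `x e` if `ẽ` is outgoing. -/
def Corresponding (φ : R.DualIdentification) (h : Θ.RestrictsTo Δ)
    (oM : Θ.Orientation (d + 1)) (oS : Δ.Orientation d)
    (κ : Θ.DualOrientation₂ d) (γ : Δ.DualOrientation₁ d)
    (F : ClosedSpinFoam R κ.skeleton) (Ψ : SpinNetwork R γ.skeleton)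
    (x : ∀ e, (Ψ.label e).1.V) (y : ∀ f, (F.label f).1.V) : Prop :=
  ∀ e : Δ.Simplex d,
    (IncomingAtEdge h oM oS κ γ e →
      (⟨F.label (tilde h e), y (tilde h e)⟩ : R.Vec) = ⟨Ψ.label e, x e⟩) ∧
    (¬ IncomingAtEdge h oM oS κ γ e →
      (⟨F.label (tilde h e), y (tilde h e)⟩ : R.Vec) = IrrepSystem.dualVec φ ⟨Ψ.label e, x e⟩)

/-- The matrix coefficient of the intertwiner of `Ψ` at `v` on the given vectors. -/
def SpinNetwork.coeffAt {γ : OrientedGraph} (Ψ : SpinNetwork R γ) (v : γ.Vertex)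
    (x : ∀ e, (Ψ.label e).1.V) : ℂ :=
  Intertwiner.coeff (Ψ.intertwiner v) (fun e => x e) (fun e => x e)

/-- The matrix coefficient of the intertwiner of `F` at `e` on the given vectors. -/
def ClosedSpinFoam.coeffAt {κ : OrientedTwoComplex} (F : ClosedSpinFoam R κ) (e : κ.Edge)
    (y : ∀ f, (F.label f).1.V) : ℂ :=
  Intertwiner.coeff (F.intertwiner e) (fun f => y f) (fun f => y f)

/-- `Ψ` is a restriction of the closed spin foam `F` to `S`.

* The label of `ẽ` is the label of `e` if `ẽ` is incoming to `e`, and its dual if `ẽ` is outgoing.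
* The intertwiner of `F` at `ṽ` is the intertwiner of `Ψ` at `v` after dualization.  If `ṽ` is
  incoming to `v`, those tensor factors (legs) for which `ẽ` is outgoing to `e` are moved between
  source and target by means of the duality between the representations `a` and `a*`.  If `ṽ` is
  outgoing to `v`, one first passes to the Hermitian adjoint, which exchanges source and target.
  In both cases this is expressed through the matrix coefficients on product vectors: moving a leg
  means pairing `x` with the functional `⟪x, ·⟫` regarded as a vector in the dual. -/
structure IsRestriction (φ : R.DualIdentification) (h : Θ.RestrictsTo Δ)
    (oM : Θ.Orientation (d + 1)) (oS : Δ.Orientation d)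
    (κ : Θ.DualOrientation₂ d) (γ : Δ.DualOrientation₁ d)
    (F : ClosedSpinFoam R κ.skeleton) (Ψ : SpinNetwork R γ.skeleton) : Prop where
  label_incoming : ∀ e : Δ.Simplex d, IncomingAtEdge h oM oS κ γ e →
    F.label (tilde h e) = Ψ.label e
  label_outgoing : ∀ e : Δ.Simplex d, ¬ IncomingAtEdge h oM oS κ γ e →
    F.label (tilde h e) = R.dual (Ψ.label e)
  intertwiner_incoming : ∀ v : Δ.Simplex (d + 1), IncomingAtVertex h oM oS κ v →
    ∀ x y, Corresponding φ h oM oS κ γ F Ψ x y →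
      F.coeffAt (tilde h v) y = Ψ.coeffAt v x
  intertwiner_outgoing : ∀ v : Δ.Simplex (d + 1), ¬ IncomingAtVertex h oM oS κ v →
    ∀ x y, Corresponding φ h oM oS κ γ F Ψ x y →
      F.coeffAt (tilde h v) y = starRingEnd ℂ (Ψ.coeffAt v x)

end Restriction

end SpinFoam

end

/-!
The condition on labels determines `Ψ.label`: it is `F.label ẽ` or its dual, and duality of labels
is involutive (`IrrepSystem.dual_dual`), because the composite of two antiunitary Riesz maps is a
unitary equivalence of `a` with the dual of `a*`.

The condition on intertwiners prescribes the matrix coefficients of `Ψ.intertwiner v` on all product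
vectors. Intertwiners correspond bijectively to the `G`-invariant functions that are linear in the
vectors at the incoming legs and conjugate-linear in those at the outgoing legs
(`Intertwiner.existsUnique_coeff_eq`), so it remains to see that the prescribed function is of this
kind. It arises from the coefficient of `F` at `ṽ` by inserting `x e` or its antiunitary image into
the leg `ẽ`, followed by a complex conjugation if `ṽ` is outgoing. Hence it is (conjugate-)linear in
the right variables exactly if the four incidence signs of `ẽ` at `ṽ`, of `e` at `v`, of `ẽ` at `e`
and of `ṽ` at `v` multiply to `1`, which is `incoming_tilde_iff_of_tgt` at the target of `e` and
`incoming_tilde_iff_of_src` at its source.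

At the target of `e` this sign rule amounts to the fact that the two top-dimensional simplices
adjacent along `v` lie on different sides of `S`. At the source one needs in addition that the
boundary of the 2-cell `ẽ` crosses `S` in opposite normal directions at the two ends of `e`
(`positiveSide_corner_iff_not`). This follows from the coherence of the two orientations: if `ẽ` is
dual to the simplex `α` and its sides are dual to `α ∪ {c i}`, the orientation of `M`
gives all `(α, c i, c (i + 1))` the same sign, whereas the orientation of `S` gives opposite signs
to `(α, c i)` at the two ends of `e`.
-/

namespace SpinFoam

/-! ### Orderings of vertices and sides of the hypersurface -/

theorem IsOrdering.exists_snoc {N k : ℕ} {p : Fin k → Space N} {σ τ : Finset (Space N)}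
    (hp : IsOrdering p σ) (hστ : σ ⊆ τ) (hτ : τ.card = k + 1) :
    ∃ b, IsOrdering (Fin.snoc (α := fun _ => Space N) p b) τ := by
  classical
  have hσ : σ.card = k := by
    have h : σ = Finset.univ.image p := by
      rw [← Finset.coe_inj, Finset.coe_image, Finset.coe_univ, Set.image_univ, hp.2]
    rw [h, Finset.card_image_of_injective _ hp.1, Finset.card_fin]
  obtain ⟨b, hb⟩ : ∃ b, τ \ σ = {b} := by
    rw [← Finset.card_eq_one, Finset.card_sdiff_of_subset hστ]
    omega
  have hbσ : b ∉ σ := fun hbσ => by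
    have : b ∈ τ \ σ := hb ▸ Finset.mem_singleton_self b
    exact (Finset.mem_sdiff.1 this).2 hbσ
  refine ⟨b, Fin.snoc_injective_iff.2 ⟨hp.1, ?_⟩, ?_⟩
  · rw [hp.2]
    exact hbσ
  · rw [Fin.range_snoc, hp.2, ← Finset.coe_insert, ← Finset.sdiff_union_of_subset hστ, hb]
    rfl

theorem IsOrdering.exists {N k : ℕ} {σ : Finset (Space N)} (hσ : σ.card = k) :
    ∃ p : Fin k → Space N, IsOrdering p σ := by
  refine ⟨fun i => (σ.equivFinOfCardEq hσ).symm i, ?_, ?_⟩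
  · exact Subtype.val_injective.comp (Equiv.injective _)
  · rw [Set.range_comp' Subtype.val, Equiv.range_eq_univ, Set.image_univ, Subtype.range_coe]

theorem IsOrdering.exists_perm {N k : ℕ} {p p' : Fin k → Space N} {σ : Finset (Space N)}
    (hp : IsOrdering p σ) (hp' : IsOrdering p' σ) : ∃ π : Equiv.Perm (Fin k), p' = p ∘ π := by
  have h : ∀ i, ∃ j, p j = p' i := fun i => by
    have : p' i ∈ Set.range p := by rw [hp.2, ← hp'.2]; exact ⟨i, rfl⟩
    exact this
  choose f hf using h
  have hinj : Function.Injective f := fun i j hij => hp'.1 (by rw [← hf, ← hf, hij])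
  exact ⟨Equiv.ofBijective f (Finite.injective_iff_bijective.1 hinj), funext fun i => (hf i).symm⟩

theorem IsOrdering.snoc_last_unique {N k : ℕ} {p p' : Fin k → Space N} {b b' : Space N}
    {σ τ : Finset (Space N)} (hp : IsOrdering p σ) (hp' : IsOrdering p' σ)
    (h : IsOrdering (Fin.snoc (α := fun _ => Space N) p b) τ)
    (h' : IsOrdering (Fin.snoc (α := fun _ => Space N) p' b') τ) : b = b' := by
  have h1 : b ∈ insert b' (Set.range p') := by
    rw [← Fin.range_snoc, h'.2, ← h.2, Fin.range_snoc]
    exact Set.mem_insert _ _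
  rcases h1 with h1 | h1
  · exact h1
  · rw [hp'.2, ← hp.2] at h1
    exact absurd h1 (Fin.snoc_injective_iff.1 h.1).2

/-- A permutation of the first `k` of `k + 1` vertices has the same sign on all `k + 1`. -/
theorem exists_perm_snoc {N k : ℕ} (p : Fin k → Space N) (b : Space N)
    (π : Equiv.Perm (Fin k)) : ∃ π' : Equiv.Perm (Fin (k + 1)),
      Equiv.Perm.sign π' = Equiv.Perm.sign π ∧
      (Fin.snoc (α := fun _ => Space N) (p ∘ π) b : Fin (k + 1) → Space N)
        = Fin.snoc (α := fun _ => Space N) p b ∘ π' := by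
  refine ⟨π.viaFintypeEmbedding Fin.castSuccEmb,
    Equiv.Perm.viaFintypeEmbedding_sign _ _, funext fun i => ?_⟩
  refine Fin.lastCases ?_ (fun j => ?_) i
  · have h : Fin.last k ∉ Set.range (Fin.castSuccEmb (n := k)) := by
      rintro ⟨j, hj⟩
      exact Fin.castSucc_ne_last j hj
    rw [Function.comp_apply, Equiv.Perm.viaFintypeEmbedding_apply_notMem_range _ _ h]
    simp
  · have h := π.viaFintypeEmbedding_apply_image (Fin.castSuccEmb (n := k)) j
    change π.viaFintypeEmbedding _ j.castSucc = (π j).castSucc at h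
    rw [Function.comp_apply, h]
    simp

section

variable {N d : ℕ} {M : Type*} [TopologicalSpace M] {S : Set M}
  {Θ : Triangulation N M} {Δ : Triangulation N S}

/-- Whether a simplex lies on the positive side can be tested on any ordering of the vertices. -/
theorem positiveSide_iff {oM : Θ.Orientation (d + 1)} {oS : Δ.Orientation d}
    {σ : Δ.Simplex (d + 1)} {τ : Θ.Simplex (d + 2)} {p : Fin (d + 1) → Space N} {b : Space N}
    (hp : IsOrdering p σ.1) (hb : IsOrdering (Fin.snoc (α := fun _ => Space N) p b) τ.1) :
    PositiveSide oM oS σ τ ↔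
      oS.sign p * oM.sign (Fin.snoc (α := fun _ => Space N) p b) = 1 := by
  refine ⟨?_, fun h => ⟨p, b, hp, hb, h⟩⟩
  rintro ⟨p', b', hp', hb', h⟩
  obtain rfl := hp.snoc_last_unique hp' hb hb'
  obtain ⟨π, rfl⟩ := hp.exists_perm hp'
  obtain ⟨π', hsign, hπ'⟩ := exists_perm_snoc p b π
  rw [hπ', oM.sign_perm τ _ hb, oS.sign_perm σ _ hp, hsign, mul_mul_mul_comm,
    Int.units_mul_self, one_mul] at h
  exact h

theorem units_mul_neg_eq_one_iff (a b : ℤˣ) : a * -b = 1 ↔ ¬ a * b = 1 := by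
  rcases Int.units_eq_one_or a with rfl | rfl <;> rcases Int.units_eq_one_or b with rfl | rfl <;>
    decide

/-- The two top-dimensional simplices adjacent along a simplex of the hypersurface lie on
different sides of it. -/
theorem positiveSide_iff_not {oM : Θ.Orientation (d + 1)} {oS : Δ.Orientation d}
    (h : Θ.RestrictsTo Δ) {σ : Δ.Simplex (d + 1)} {τ τ' : Θ.Simplex (d + 2)}
    (hτ : σ.1 ⊆ τ.1) (hτ' : σ.1 ⊆ τ'.1) (hne : τ ≠ τ') :
    PositiveSide oM oS σ τ ↔ ¬ PositiveSide oM oS σ τ' := by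
  obtain ⟨p, hp⟩ := IsOrdering.exists σ.2.2
  obtain ⟨b, hb⟩ := hp.exists_snoc hτ τ.2.2
  obtain ⟨b', hb'⟩ := hp.exists_snoc hτ' τ'.2.2
  rw [positiveSide_iff hp hb, positiveSide_iff hp hb',
    oM.coherent (tilde h σ) τ τ' p b b' hne hp hb hb', units_mul_neg_eq_one_iff]

/-! ### Going around a 2-cell -/

/-- Let the sides of the 2-cell dual to `α` be dual to `α ∪ {c i}`.  Then its corners are dual to
`α ∪ {c i, c (i + 1)}`, and coherence of the orientation makes the sign of
`(α, c i, c (i + 1))` independent of `i`. -/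
theorem exists_cyclic_vertices (oM : Θ.Orientation (d + 1)) (κ : Θ.DualOrientation₂ d)
    (α : Θ.Simplex d) {q : Fin d → Space N} (hq : IsOrdering q α.1) :
    ∃ (c : ZMod (κ.sides α) → Space N) (ε : ℤˣ), ∀ i,
      IsOrdering (Fin.snoc (α := fun _ => Space N) q (c i)) (κ.side α i).1 ∧
      IsOrdering (Fin.snoc (α := fun _ => Space N)
        (Fin.snoc (α := fun _ => Space N) q (c i)) (c (i + 1))) (κ.corner α (i + 1)).1 ∧
      oM.sign (Fin.snoc (α := fun _ => Space N)
        (Fin.snoc (α := fun _ => Space N) q (c i)) (c (i + 1))) = ε := by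
  have h3 := κ.three_le_sides α
  have : Fact (1 < κ.sides α) := ⟨by omega⟩
  have hsub : ∀ i, α.1 ⊆ (κ.side α i).1 := fun i => (κ.subset_iff_side _ _).2 ⟨i, rfl⟩
  choose c hc using fun i => hq.exists_snoc (hsub i) (κ.side α i).2.2
  have hcinj : Function.Injective c := fun i j hij => by
    refine κ.side_injective α (Subtype.ext (Finset.coe_injective ?_))
    rw [← (hc i).2, ← (hc j).2, hij]
  have hcmem : ∀ i, c i ∈ (κ.side α i).1 := fun i => by
    rw [← Finset.mem_coe, ← (hc i).2, Fin.range_snoc]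
    exact Set.mem_insert _ _
  -- A corner with the vertices of one of its sides `j` and the vertex `c k` of another.
  have key : ∀ i j k, j ≠ k → (κ.side α j).1 ⊆ (κ.corner α i).1 →
      (κ.side α k).1 ⊆ (κ.corner α i).1 →
      IsOrdering (Fin.snoc (α := fun _ => Space N)
        (Fin.snoc (α := fun _ => Space N) q (c j)) (c k)) (κ.corner α i).1 := by
    intro i j k hjk hj hk
    obtain ⟨b, hb⟩ := (hc j).exists_snoc hj (κ.corner α i).2.2
    suffices c k = b by rwa [this]
    have h1 : c k ∈ Set.range (Fin.snoc (α := fun _ => Space N)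
        (Fin.snoc (α := fun _ => Space N) q (c j)) b : Fin (d + 2) → Space N) := by
      rw [hb.2]
      exact hk (hcmem k)
    rw [Fin.range_snoc, Fin.range_snoc] at h1
    rcases h1 with h1 | h1 | h1
    · exact h1
    · exact absurd (hcinj h1).symm hjk
    · exact absurd h1 (Fin.snoc_injective_iff.1 (hc k).1).2
  have hne : ∀ i : ZMod (κ.sides α), i ≠ i + 1 := fun i hi => one_ne_zero (left_eq_add.1 hi)
  have hcorner := fun i => key (i + 1) i (i + 1) (hne i) (κ.side_subset_corner_succ α i)
    (κ.side_subset_corner α (i + 1))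
  have hcorner' := fun i => key (i + 1) (i + 1) i (hne i).symm
    (κ.side_subset_corner α (i + 1)) (κ.side_subset_corner_succ α i)
  let s : ZMod (κ.sides α) → ℤˣ := fun i => oM.sign (Fin.snoc (α := fun _ => Space N)
    (Fin.snoc (α := fun _ => Space N) q (c i)) (c (i + 1)))
  have hstep : ∀ i, s (i + 1) = s i := by
    intro i
    have h1 := oM.coherent (κ.side α (i + 1)) (κ.corner α (i + 1 + 1)) (κ.corner α (i + 1))
      _ _ _ (fun h => hne _ (κ.corner_injective α h).symm) (hc (i + 1)) (hcorner (i + 1))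
      (hcorner' i)
    have h2 := oM.sign_perm (κ.corner α (i + 1)) _ (hcorner i)
      (Equiv.swap (Fin.last (d + 1)) (Fin.last d).castSucc)
    have h3 : (Fin.snoc (α := fun _ => Space N)
        (Fin.snoc (α := fun _ => Space N) q (c i)) (c (i + 1)) : Fin (d + 2) → Space N) ∘
        Equiv.swap (Fin.last (d + 1)) (Fin.last d).castSucc =
        Fin.snoc (α := fun _ => Space N) (Fin.snoc (α := fun _ => Space N) q (c (i + 1)))
          (c i) := by
      funext j
      refine Fin.lastCases ?_ (fun j => Fin.lastCases ?_ (fun j => ?_) j) j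
      · simp
      · simp
      · rw [Function.comp_apply, Equiv.swap_apply_of_ne_of_ne (Fin.castSucc_ne_last _)
          (fun h => Fin.castSucc_ne_last _ (Fin.castSucc_injective _ h))]
        simp
    rw [h3, Equiv.Perm.sign_swap (Fin.castSucc_ne_last _).symm, neg_one_mul] at h2
    change _ = s i
    rw [← neg_neg (s i)]
    exact h1.trans (congrArg _ h2)
  have hconst : ∀ k : ℕ, s k = s 0 := fun k => by
    induction k with
    | zero => rw [Nat.cast_zero]
    | succ k ih => rw [Nat.cast_succ, hstep, ih]
  refine ⟨c, s 0, fun i => ⟨hc i, hcorner i, ?_⟩⟩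
  have : NeZero (κ.sides α) := ⟨by omega⟩
  have := hconst i.val
  rwa [ZMod.natCast_zmod_val] at this

/-- A 2-cell crosses the hypersurface at both ends of the edge in which it meets it, in opposite
normal directions. -/
theorem positiveSide_corner_iff_not (h : Θ.RestrictsTo Δ) {oM : Θ.Orientation (d + 1)}
    {oS : Δ.Orientation d} (κ : Θ.DualOrientation₂ d) {e : Δ.Simplex d}
    {v w : Δ.Simplex (d + 1)} (hvw : v ≠ w) {i j : ZMod (κ.sides (tilde h e))}
    (hi : κ.side (tilde h e) i = tilde h v) (hj : κ.side (tilde h e) j = tilde h w) :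
    PositiveSide oM oS v (κ.corner (tilde h e) (i + 1)) ↔
      ¬ PositiveSide oM oS w (κ.corner (tilde h e) (j + 1)) := by
  obtain ⟨q, hq⟩ := IsOrdering.exists e.2.2
  obtain ⟨c, ε, hc⟩ := exists_cyclic_vertices oM κ (tilde h e) hq
  obtain ⟨h1, h2, h3⟩ := hc i
  obtain ⟨h1', h2', h3'⟩ := hc j
  rw [hi] at h1
  rw [hj] at h1'
  have h4 := oS.coherent e v w q _ _ hvw hq h1 h1'
  rw [positiveSide_iff h1 h2, positiveSide_iff h1' h2', h3, h3', h4, neg_mul, ← mul_neg,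
    units_mul_neg_eq_one_iff]

/-! ### Incidence of faces and edges in the dual complex -/

theorem incoming_or_outgoing (κ : Θ.DualOrientation₂ d) {α : Θ.Simplex d}
    {σ : Θ.Simplex (d + 1)} :
    (κ.skeleton.Incoming α σ ∨ κ.skeleton.Outgoing α σ) ↔ α.1 ⊆ σ.1 := by
  rw [κ.subset_iff_side]
  constructor
  · rintro (⟨i, hi, -⟩ | ⟨i, hi, -⟩) <;> exact ⟨i, hi⟩
  · rintro ⟨i, rfl⟩
    rcases κ.skeleton.side_ends α i with hi | hi
    · exact Or.inl ⟨i, rfl, hi⟩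
    · exact Or.inr ⟨i, rfl, hi⟩

theorem incoming_iff (κ : Θ.DualOrientation₂ d) {α : Θ.Simplex d}
    {σ : Θ.Simplex (d + 1)} {i : ZMod (κ.sides α)} (hi : κ.side α i = σ) :
    κ.skeleton.Incoming α σ ↔ κ.tgt σ = κ.corner α (i + 1) := by
  constructor
  · rintro ⟨j, hj, -, h⟩
    have := κ.side_injective α (hj.trans hi.symm)
    subst this
    exact h
  · intro h
    subst hi
    rcases κ.skeleton.side_ends α i with hi | hi
    · exact ⟨i, rfl, hi⟩
    · exact absurd (hi.2.trans h.symm) (κ.src_ne_tgt _)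

theorem not_incoming_and_outgoing (κ : Θ.DualOrientation₂ d) {α : Θ.Simplex d}
    {σ : Θ.Simplex (d + 1)} (h : κ.skeleton.Incoming α σ) : ¬ κ.skeleton.Outgoing α σ := by
  rintro ⟨i, hi, -, h'⟩
  exact κ.src_ne_tgt σ (h'.trans ((incoming_iff κ hi).1 h).symm)

theorem incoming_iff_positiveSide (h : Θ.RestrictsTo Δ) {oM : Θ.Orientation (d + 1)}
    {oS : Δ.Orientation d} (κ : Θ.DualOrientation₂ d) {e : Δ.Simplex d}
    {v : Δ.Simplex (d + 1)} {i : ZMod (κ.sides (tilde h e))}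
    (hi : κ.side (tilde h e) i = tilde h v) :
    κ.skeleton.Incoming (tilde h e) (tilde h v) ↔
      (PositiveSide oM oS v (κ.corner (tilde h e) (i + 1)) ↔ IncomingAtVertex h oM oS κ v) := by
  have hends : κ.tgt (tilde h v) = κ.corner (tilde h e) (i + 1) ∨
      κ.src (tilde h v) = κ.corner (tilde h e) (i + 1) := by
    rw [← hi]
    exact (κ.skeleton.side_ends (tilde h e) i).imp And.right And.right
  have hst := κ.src_ne_tgt (tilde h v)
  have hflip := positiveSide_iff_not (oM := oM) (oS := oS) h
    (show v.1 ⊆ _ from (κ.subset_iff (tilde h v) _).2 (Or.inl rfl))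
    (show v.1 ⊆ _ from (κ.subset_iff (tilde h v) _).2 (Or.inr rfl)) hst
  rw [incoming_iff κ hi, IncomingAtVertex]
  rcases hends with h1 | h1
  · rw [← h1]
    exact iff_of_true rfl Iff.rfl
  · rw [← h1]
    exact iff_of_false hst.symm (by tauto)

theorem incoming_tilde_iff_of_tgt (h : Θ.RestrictsTo Δ) {oM : Θ.Orientation (d + 1)}
    {oS : Δ.Orientation d} (κ : Θ.DualOrientation₂ d) (γ : Δ.DualOrientation₁ d)
    (e : Δ.Simplex d) :
    κ.skeleton.Incoming (tilde h e) (tilde h (γ.tgt e)) ↔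
      (IncomingAtEdge h oM oS κ γ e ↔ IncomingAtVertex h oM oS κ (γ.tgt e)) := by
  obtain ⟨i, hi⟩ := (κ.subset_iff_side (tilde h e) (tilde h (γ.tgt e))).1
    ((γ.subset_iff e _).2 (Or.inr rfl))
  rw [incoming_iff_positiveSide (oM := oM) (oS := oS) h κ hi]
  refine iff_congr ⟨fun h' => ⟨i, hi, h'⟩, ?_⟩ Iff.rfl
  rintro ⟨j, hj, h'⟩
  rwa [κ.side_injective _ (hi.trans hj.symm)]

theorem incoming_tilde_iff_of_src (h : Θ.RestrictsTo Δ) {oM : Θ.Orientation (d + 1)}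
    {oS : Δ.Orientation d} (κ : Θ.DualOrientation₂ d) (γ : Δ.DualOrientation₁ d)
    (e : Δ.Simplex d) :
    κ.skeleton.Incoming (tilde h e) (tilde h (γ.src e)) ↔
      ¬ (IncomingAtEdge h oM oS κ γ e ↔ IncomingAtVertex h oM oS κ (γ.src e)) := by
  obtain ⟨i, hi⟩ := (κ.subset_iff_side (tilde h e) (tilde h (γ.src e))).1
    ((γ.subset_iff e _).2 (Or.inl rfl))
  rw [incoming_iff_positiveSide (oM := oM) (oS := oS) h κ hi]
  have h2 : PositiveSide oM oS (γ.src e) (κ.corner (tilde h e) (i + 1)) ↔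
      ¬ IncomingAtEdge h oM oS κ γ e := by
    obtain ⟨j, hj⟩ := (κ.subset_iff_side (tilde h e) (tilde h (γ.tgt e))).1
      ((γ.subset_iff e _).2 (Or.inr rfl))
    rw [positiveSide_corner_iff_not h κ (γ.src_ne_tgt e) hi hj, not_iff_not]
    refine ⟨fun h' => ⟨j, hj, h'⟩, ?_⟩
    rintro ⟨k, hk, h'⟩
    rwa [κ.side_injective _ (hj.trans hk.symm)]
  rw [h2]
  tauto

/-- Every face of a simplex of the hypersurface is a simplex of the hypersurface. -/
theorem exists_tilde_eq (h : Θ.RestrictsTo Δ) {σ : Δ.Simplex (d + 1)} {α : Θ.Simplex d}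
    (hα : α.1 ⊆ σ.1) : ∃ e : Δ.Simplex d, tilde h e = α :=
  ⟨⟨α.1, Δ.complex.down_closed σ.2.1 hα (Θ.complex.nonempty_of_mem_faces α.2.1), α.2.2⟩, rfl⟩

theorem tilde_injective (h : Θ.RestrictsTo Δ) {k : ℕ} :
    Function.Injective (tilde h (k := k)) := fun _ _ he =>
  Subtype.ext (congrArg (fun σ : Θ.Simplex k => σ.1) he)

end

/-! ### Tensor products and matrix coefficients -/

section Bra

variable {J : Type*} {V : J → Type*} [∀ j, NormedAddCommGroup (V j)]
  [∀ j, InnerProductSpace ℂ (V j)]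

/-- The functional `⟪⨂ j, y j, ·⟫` on a tensor product of Hilbert spaces. -/
noncomputable def bra [Finite J] (y : ∀ j, V j) : Module.Dual ℂ (⨂[ℂ] j, V j) :=
  PiTensorProduct.dualDistrib
    (⨂ₜ[ℂ] j, (innerSL ℂ (y j) : StrongDual ℂ (V j)).toLinearMap)

theorem bra_tprod [Fintype J] (y x : ∀ j, V j) :
    bra y (⨂ₜ[ℂ] j, x j) = ∏ j, inner ℂ (y j) (x j) := by
  rw [bra, PiTensorProduct.dualDistrib_apply]
  rfl

theorem bra_update_add [Finite J] [DecidableEq J] (y : ∀ j, V j) (j : J) (u v : V j) :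
    bra (Function.update y j (u + v)) =
      bra (Function.update y j u) + bra (Function.update y j v) := by
  have := Fintype.ofFinite J
  refine PiTensorProduct.ext (MultilinearMap.ext fun x => ?_)
  simp only [LinearMap.compMultilinearMap_apply, LinearMap.add_apply, bra_tprod]
  simp only [Function.apply_update (fun j (z : V j) => inner ℂ z (x j)), inner_add_left,
    Finset.prod_update_of_mem (Finset.mem_univ j), add_mul]

theorem bra_update_smul [Finite J] [DecidableEq J] (y : ∀ j, V j) (j : J) (c : ℂ) (u : V j) :
    bra (Function.update y j (c • u)) = starRingEnd ℂ c • bra (Function.update y j u) := by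
  have := Fintype.ofFinite J
  refine PiTensorProduct.ext (MultilinearMap.ext fun x => ?_)
  simp only [LinearMap.compMultilinearMap_apply, LinearMap.smul_apply, bra_tprod]
  simp only [Function.apply_update (fun j (z : V j) => inner ℂ z (x j)), inner_smul_left,
    Finset.prod_update_of_mem (Finset.mem_univ j), smul_eq_mul, mul_assoc]

variable [∀ j, FiniteDimensional ℂ (V j)]

/-- Expansion of a tensor in the orthonormal basis formed by the products of vectors from
orthonormal bases of the factors. -/
theorem sum_bra_smul_tprod [Fintype J] [DecidableEq J] (t : ⨂[ℂ] j, V j) :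
    ∑ k : ∀ j, Fin (Module.finrank ℂ (V j)),
      bra (fun j => stdOrthonormalBasis ℂ (V j) (k j)) t •
        (⨂ₜ[ℂ] j, stdOrthonormalBasis ℂ (V j) (k j)) = t := by
  induction t using PiTensorProduct.induction_on with
  | smul_tprod c x =>
    simp only [map_smul, smul_assoc, ← Finset.smul_sum]
    congr 1
    conv_rhs => rw [show x = fun j => ∑ i, inner ℂ (stdOrthonormalBasis ℂ (V j) i) (x j) •
      stdOrthonormalBasis ℂ (V j) i from
        funext fun j => ((stdOrthonormalBasis ℂ (V j)).sum_repr' (x j)).symm]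
    rw [MultilinearMap.map_sum]
    refine Finset.sum_congr rfl fun k _ => ?_
    rw [MultilinearMap.map_smul_univ, bra_tprod]
  | add a b ha hb =>
    simp only [map_add, add_smul, Finset.sum_add_distrib, ha, hb]

theorem tensor_ext_bra [Finite J] {t t' : ⨂[ℂ] j, V j} (h : ∀ y, bra y t = bra y t') :
    t = t' := by
  classical
  have := Fintype.ofFinite J
  rw [← sum_bra_smul_tprod t, ← sum_bra_smul_tprod t']
  simp only [h]

/-- Every map that is multilinear in `x` and conjugate-multilinear in `y` is a matrix coefficient
`⟪⨂ j, y j, T (⨂ i, x i)⟫`. -/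
theorem exists_linearMap_bra {I : Type*} {W : I → Type*} [∀ i, NormedAddCommGroup (W i)]
    [∀ i, InnerProductSpace ℂ (W i)] [Finite J] (C : (∀ i, W i) → (∀ j, V j) → ℂ)
    (hx : ∀ y, ∃ m : MultilinearMap ℂ W ℂ, ∀ x, C x y = m x)
    (hy : ∀ x, ∃ m : MultilinearMap ℂ V ℂ, ∀ y, starRingEnd ℂ (C x y) = m y) :
    ∃ T : (⨂[ℂ] i, W i) →ₗ[ℂ] ⨂[ℂ] j, V j,
      ∀ x y, bra y (T (⨂ₜ[ℂ] i, x i)) = C x y := by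
  classical
  have := Fintype.ofFinite J
  choose m hm using hx
  let b : (∀ j, Fin (Module.finrank ℂ (V j))) → ∀ j, V j :=
    fun k j => stdOrthonormalBasis ℂ (V j) (k j)
  refine ⟨∑ k, (PiTensorProduct.lift (m (b k))).smulRight (⨂ₜ[ℂ] j, b k j), fun x y => ?_⟩
  obtain ⟨m', hm'⟩ := hy x
  apply (starRingEnd ℂ).injective
  rw [hm']
  conv_rhs => rw [show y = fun j => ∑ i, inner ℂ (stdOrthonormalBasis ℂ (V j) i) (y j) •
      stdOrthonormalBasis ℂ (V j) i from
        funext fun j => ((stdOrthonormalBasis ℂ (V j)).sum_repr' (y j)).symm]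
  rw [MultilinearMap.map_sum, LinearMap.sum_apply, map_sum, map_sum]
  refine Finset.sum_congr rfl fun k _ => ?_
  rw [MultilinearMap.map_smul_univ, ← hm', LinearMap.smulRight_apply, map_smul,
    PiTensorProduct.lift.tprod, ← hm, bra_tprod, smul_eq_mul, smul_eq_mul, map_mul, map_prod,
    mul_comm]
  simp only [inner_conj_symm]
  rfl

end Bra

section Coefficients

variable {G : Type*} [Group G] [TopologicalSpace G] {R : IrrepSystem.{u} G} {I J : Type*}
  [Finite J] {a : I → R.Label} {b : J → R.Label}

theorem bra_rep (g : G) (y : ∀ j, (b j).1.V) (t : ⨂[ℂ] j, (b j).1.V) :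
    bra (fun j => (b j).1.rep g (y j)) (tensorRep b g t) = bra y t := by
  have := Fintype.ofFinite J
  refine LinearMap.congr_fun (f := bra (fun j => (b j).1.rep g (y j)) ∘ₗ tensorRep b g) ?_ t
  refine PiTensorProduct.ext (MultilinearMap.ext fun x => ?_)
  have h : tensorRep b g (⨂ₜ[ℂ] j, x j) = ⨂ₜ[ℂ] j, (b j).1.rep g (x j) :=
    PiTensorProduct.map_tprod _ _
  simp only [LinearMap.compMultilinearMap_apply, LinearMap.comp_apply, h, bra_tprod, inner_rep]

theorem Intertwiner.coeff_eq_bra (T : Intertwiner a b) (x : ∀ i, (a i).1.V)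
    (y : ∀ j, (b j).1.V) : T.coeff x y = bra y (T (⨂ₜ[ℂ] i, x i)) := rfl

theorem Intertwiner.coeff_rep (T : Intertwiner a b) (g : G) (x : ∀ i, (a i).1.V)
    (y : ∀ j, (b j).1.V) :
    T.coeff (fun i => (a i).1.rep g (x i)) (fun j => (b j).1.rep g (y j)) = T.coeff x y := by
  have h : (⨂ₜ[ℂ] i, (a i).1.rep g (x i)) = tensorRep a g (⨂ₜ[ℂ] i, x i) :=
    (PiTensorProduct.map_tprod _ _).symm
  rw [coeff_eq_bra, coeff_eq_bra, h, T.isIntertwining, bra_rep]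

theorem Intertwiner.ext_coeff {T T' : Intertwiner a b}
    (h : ∀ x y, T.coeff x y = T'.coeff x y) : T = T' :=
  Representation.IntertwiningMap.ext <| PiTensorProduct.ext <| MultilinearMap.ext fun x =>
    tensor_ext_bra fun y => h x y

/-- Every `G`-invariant map that is multilinear in `x` and conjugate-multilinear in `y` is the
matrix coefficient of an intertwiner. -/
theorem Intertwiner.exists_coeff_eq (C : (∀ i, (a i).1.V) → (∀ j, (b j).1.V) → ℂ)
    (hx : ∀ y, ∃ m : MultilinearMap ℂ (fun i => (a i).1.V) ℂ, ∀ x, C x y = m x)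
    (hy : ∀ x, ∃ m : MultilinearMap ℂ (fun j => (b j).1.V) ℂ,
      ∀ y, starRingEnd ℂ (C x y) = m y)
    (hG : ∀ (g : G) x y,
      C (fun i => (a i).1.rep g (x i)) (fun j => (b j).1.rep g (y j)) = C x y) :
    ∃ T : Intertwiner a b, ∀ x y, T.coeff x y = C x y := by
  obtain ⟨T, hT⟩ := exists_linearMap_bra C hx hy
  refine ⟨⟨T, fun g => PiTensorProduct.ext <| MultilinearMap.ext fun x =>
    tensor_ext_bra fun y => ?_⟩, hT⟩
  have h : tensorRep a g (⨂ₜ[ℂ] i, x i) = ⨂ₜ[ℂ] i, (a i).1.rep g (x i) :=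
    PiTensorProduct.map_tprod _ _
  -- By invariance the factor `g` can be moved across the coefficient as `g⁻¹`.
  have hy : y = fun j => (b j).1.rep g ((b j).1.rep g⁻¹ (y j)) := funext fun j => by
    rw [← Module.End.mul_apply, ← map_mul, mul_inv_cancel, map_one, Module.End.one_apply]
  simp only [LinearMap.compMultilinearMap_apply, LinearMap.comp_apply, h]
  rw [hT]
  conv_lhs => rw [hy]
  conv_rhs => rw [hy]
  rw [hG, bra_rep, hT]

end Coefficients

/-! ### Sesquilinear functions of a family of vectors -/

section Families

variable {E : Type*} {V : E → Type*}

theorem restrict_update [DecidableEq E] {s : E → Prop} [DecidableEq {e // s e}]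
    (x : ∀ e, V e) {e : E} (he : s e) (u : V e) :
    (fun f : {f // s f} => Function.update x e u f) =
      Function.update (fun f : {f // s f} => x f) ⟨e, he⟩ u := by
  funext ⟨f, hf⟩
  rcases eq_or_ne f e with rfl | h
  · simp
  · rw [Function.update_of_ne h, Function.update_of_ne (fun h' => h (congrArg Subtype.val h'))]

theorem restrict_update_of_not [DecidableEq E] {s : E → Prop}
    (x : ∀ e, V e) {e : E} (he : ¬ s e) (u : V e) :
    (fun f : {f // s f} => Function.update x e u f) = fun f : {f // s f} => x f := by
  funext ⟨f, hf⟩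
  rw [Function.update_of_ne]
  rintro rfl
  exact he hf

variable [∀ e, Zero (V e)]

theorem exists_family_extending {E' : Type*} {i : E' → E} (hi : Function.Injective i)
    (w : ∀ e, V (i e)) : ∃ y : ∀ f, V f, ∀ e, y (i e) = w e := by
  have hf : ∀ f, ∃ y : V f, ∀ e, (h : i e = f) → y = h ▸ w e := fun f => by
    by_cases h : ∃ e, i e = f
    · obtain ⟨e, rfl⟩ := h
      refine ⟨w e, fun e' h => ?_⟩
      obtain rfl := hi h
      rfl
    · exact ⟨0, fun e he => absurd ⟨e, he⟩ h⟩
  choose y hy using hf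
  exact ⟨y, fun e => hy _ e rfl⟩

open Classical in
/-- The family given by `x` on `s`, by `y` on the rest of `t`, and by `0` elsewhere. -/
noncomputable def glue {s t : E → Prop} (x : ∀ e : {e // s e}, V e) (y : ∀ e : {e // t e}, V e)
    (e : E) : V e :=
  if hs : s e then x ⟨e, hs⟩ else if ht : t e then y ⟨e, ht⟩ else 0

theorem glue_update_left [DecidableEq E] {s t : E → Prop} [DecidableEq {e // s e}]
    (x : ∀ e : {e // s e}, V e)
    (y : ∀ e : {e // t e}, V e) (e : {e // s e}) (u : V e) :
    glue (Function.update x e u) y = Function.update (glue x y) e u := by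
  obtain ⟨e, he⟩ := e
  funext f
  rcases eq_or_ne f e with rfl | hf
  · simp [glue, he]
  · rw [Function.update_of_ne hf]
    unfold glue
    split_ifs with h1
    · rw [Function.update_of_ne (fun h => hf (congrArg Subtype.val h))]
    all_goals rfl

theorem glue_update_right [DecidableEq E] {s t : E → Prop} [DecidableEq {e // t e}]
    (hst : ∀ e, s e → ¬ t e) (x : ∀ e : {e // s e}, V e)
    (y : ∀ e : {e // t e}, V e) (e : {e // t e}) (u : V e) :
    glue x (Function.update y e u) = Function.update (glue x y) e u := by
  obtain ⟨e, he⟩ := e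
  funext f
  rcases eq_or_ne f e with rfl | hf
  · have : ¬ s f := fun h => hst f h he
    simp [glue, he, this]
  · rw [Function.update_of_ne hf]
    unfold glue
    split_ifs with h1 h2
    · rfl
    · rw [Function.update_of_ne (fun h => hf (congrArg Subtype.val h))]
    · rfl

end Families

section Sesquilinear

variable {E : Type*} {V : E → Type*} [∀ e, AddCommGroup (V e)] [∀ e, Module ℂ (V e)]

open Classical in
/-- A function of a family of vectors that depends only on the members of the family with index
in `s ∪ t`, is linear in those with index in `s`, and conjugate-linear in those with index in `t`
but not in `s`. -/
structure IsSesquilinear (s t : E → Prop) (C : (∀ e, V e) → ℂ) : Prop where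
  congr : ∀ x x', (∀ e, s e ∨ t e → x e = x' e) → C x = C x'
  map_update_add : ∀ x e u v, s e ∨ t e →
    C (Function.update x e (u + v)) = C (Function.update x e u) + C (Function.update x e v)
  map_update_smul : ∀ x e (c : ℂ) u, s e ∨ t e →
    C (Function.update x e (c • u)) =
      (if s e then c else starRingEnd ℂ c) * C (Function.update x e u)

/-- Pulling back along maps of the individual vectors that are linear for `e` with `ℓ e` and
conjugate-linear for the others. -/
theorem IsSesquilinear.comp {E' : Type*} {W : E' → Type*} [∀ f, AddCommGroup (W f)]
    [∀ f, Module ℂ (W f)] {s' t' : E' → Prop} {D : (∀ f, W f) → ℂ}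
    (hD : IsSesquilinear s' t' D) {i : E → E'} (hi : Function.Injective i)
    {s t : E → Prop} {ℓ : E → Prop} (hst : ∀ f, s' f ∨ t' f → ∃ e, i e = f ∧ (s e ∨ t e))
    (hst' : ∀ e, s e ∨ t e → s' (i e) ∨ t' (i e))
    (hs : ∀ e, s e ∨ t e → (s e ↔ (ℓ e ↔ s' (i e))))
    (m : ∀ e, V e → W (i e)) (hadd : ∀ e u v, m e (u + v) = m e u + m e v)
    (hlin : ∀ e (c : ℂ) u, ℓ e → m e (c • u) = c • m e u)
    (hconj : ∀ e (c : ℂ) u, ¬ ℓ e → m e (c • u) = starRingEnd ℂ c • m e u)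
    {C : (∀ e, V e) → ℂ} (hC : ∀ x y, (∀ e, y (i e) = m e (x e)) → C x = D y) :
    IsSesquilinear s t C := by
  classical
  have hy : ∀ x : ∀ e, V e, ∃ y : ∀ f, W f, ∀ e, y (i e) = m e (x e) := fun x =>
    exists_family_extending hi fun e => m e (x e)
  have hupd : ∀ x y e u, (∀ e, y (i e) = m e (x e)) →
      C (Function.update x e u) = D (Function.update y (i e) (m e u)) := fun x y e u h => by
    refine hC _ _ fun e' => ?_
    rcases eq_or_ne e' e with rfl | hne
    · simp
    · rw [Function.update_of_ne hne, Function.update_of_ne (hi.ne hne), h]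
  refine ⟨fun x x' h => ?_, fun x e u v he => ?_, fun x e c u he => ?_⟩
  · obtain ⟨y, hy1⟩ := hy x
    obtain ⟨y', hy2⟩ := hy x'
    rw [hC x y hy1, hC x' y' hy2]
    refine hD.congr _ _ fun f hf => ?_
    obtain ⟨e, rfl, he⟩ := hst f hf
    rw [hy1, hy2, h e he]
  · obtain ⟨y, hy⟩ := hy x
    simp only [hupd x y e _ hy, hadd]
    exact hD.map_update_add _ _ _ _ (hst' e he)
  · obtain ⟨y, hy⟩ := hy x
    simp only [hupd x y e _ hy]
    have hs := hs e he
    by_cases hℓ : ℓ e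
    · rw [hlin e c u hℓ, hD.map_update_smul _ _ _ _ (hst' e he)]
      simp only [hs, hℓ, true_iff]
    · rw [hconj e c u hℓ, hD.map_update_smul _ _ _ _ (hst' e he)]
      by_cases h' : s' (i e) <;> simp [hs, hℓ, h']

theorem IsSesquilinear.conj {s t : E → Prop} (hst : ∀ e, s e → ¬ t e) {C : (∀ e, V e) → ℂ}
    (hC : IsSesquilinear s t C) : IsSesquilinear t s (fun x => starRingEnd ℂ (C x)) := by
  refine ⟨fun x x' h => congrArg _ (hC.congr x x' fun e he => h e he.symm), ?_, ?_⟩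
  · intro x e u v he
    rw [hC.map_update_add _ _ _ _ he.symm, map_add]
  · intro x e c u he
    simp only [hC.map_update_smul _ _ _ _ he.symm, map_mul]
    congr 1
    rcases he with he | he
    · have : ¬ s e := fun h => hst e h he
      simp [he, this]
    · simp [he, hst e he]

end Sesquilinear

section SesquilinearCoefficients

variable {G : Type*} [Group G] [TopologicalSpace G] {R : IrrepSystem.{u} G} {E : Type*}
  {a : E → R.Label} {s t : E → Prop} [Finite {e // t e}]

theorem Intertwiner.isSesquilinear_coeff (hst : ∀ e, s e → ¬ t e)
    (T : Intertwiner (fun e : {e // s e} => a e) (fun e : {e // t e} => a e)) :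
    IsSesquilinear (V := fun e => (a e).1.V) s t
      (fun x => T.coeff (fun e => x e) (fun e => x e)) := by
  classical
  refine ⟨fun x x' h => ?_, fun x e u v he => ?_, fun x e c u he => ?_⟩
  · have h1 : (fun e : {e // s e} => x e) = fun e : {e // s e} => x' e :=
      funext fun e => h e (Or.inl e.2)
    have h2 : (fun e : {e // t e} => x e) = fun e : {e // t e} => x' e :=
      funext fun e => h e (Or.inr e.2)
    rw [h1, h2]
  · simp only [coeff_eq_bra]
    by_cases hs : s e
    · simp only [restrict_update_of_not x (hst e hs), restrict_update x hs,
        MultilinearMap.map_update_add, map_add]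
    · have ht := he.resolve_left hs
      simp only [restrict_update_of_not x hs, restrict_update x ht, bra_update_add,
        LinearMap.add_apply]
  · simp only [coeff_eq_bra]
    by_cases hs : s e
    · simp only [restrict_update_of_not x (hst e hs), restrict_update x hs,
        MultilinearMap.map_update_smul, map_smul, if_pos hs, smul_eq_mul]
    · have ht := he.resolve_left hs
      simp only [restrict_update_of_not x hs, restrict_update x ht, bra_update_smul,
        LinearMap.smul_apply, if_neg hs, smul_eq_mul]

/-- Intertwiners correspond bijectively to the invariant sesquilinear functions of the vectors at
their legs. -/
theorem Intertwiner.existsUnique_coeff_eq (hst : ∀ e, s e → ¬ t e)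
    {C : (∀ e, (a e).1.V) → ℂ} (hC : IsSesquilinear (V := fun e => (a e).1.V) s t C)
    (hG : ∀ (g : G) x, C (fun e => (a e).1.rep g (x e)) = C x) :
    ∃! T : Intertwiner (fun e : {e // s e} => a e) (fun e : {e // t e} => a e),
      ∀ x : ∀ e, (a e).1.V, T.coeff (fun e => x e) (fun e => x e) = C x := by
  classical
  let K : (∀ e : {e // s e}, (a e).1.V) → (∀ e : {e // t e}, (a e).1.V) → ℂ :=
    fun x y => C (glue (V := fun e => (a e).1.V) x y)
  have hl : ∀ (x : ∀ e : {e // s e}, (a e).1.V) (y : ∀ e : {e // t e}, (a e).1.V),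
      (fun e : {e // s e} => glue (V := fun e => (a e).1.V) x y e) = x := fun x y =>
    funext fun e => dif_pos e.2
  have hr : ∀ (x : ∀ e : {e // s e}, (a e).1.V) (y : ∀ e : {e // t e}, (a e).1.V),
      (fun e : {e // t e} => glue (V := fun e => (a e).1.V) x y e) = y := fun x y =>
    funext fun e => (dif_neg fun h => hst _ h e.2).trans (dif_pos e.2)
  have hxadd : ∀ [DecidableEq {e // s e}] x y (e : {e // s e}) (u v : (a e).1.V),
      K (Function.update x e (u + v)) y =
        K (Function.update x e u) y + K (Function.update x e v) y := by
    intro _ x y e u v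
    simp only [K, glue_update_left]
    exact hC.map_update_add _ _ _ _ (Or.inl e.2)
  have hxsmul : ∀ [DecidableEq {e // s e}] x y (e : {e // s e}) (c : ℂ) (u : (a e).1.V),
      K (Function.update x e (c • u)) y = c * K (Function.update x e u) y := by
    intro _ x y e c u
    simp only [K, glue_update_left]
    exact (hC.map_update_smul _ _ _ _ (Or.inl e.2)).trans (by rw [if_pos e.2])
  have hyadd : ∀ [DecidableEq {e // t e}] x y (e : {e // t e}) (u v : (a e).1.V),
      K x (Function.update y e (u + v)) =
        K x (Function.update y e u) + K x (Function.update y e v) := by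
    intro _ x y e u v
    simp only [K, glue_update_right hst]
    exact hC.map_update_add _ _ _ _ (Or.inr e.2)
  have hysmul : ∀ [DecidableEq {e // t e}] x y (e : {e // t e}) (c : ℂ) (u : (a e).1.V),
      K x (Function.update y e (c • u)) = starRingEnd ℂ c * K x (Function.update y e u) := by
    intro _ x y e c u
    simp only [K, glue_update_right hst]
    exact (hC.map_update_smul _ _ _ _ (Or.inr e.2)).trans (by rw [if_neg fun h => hst _ h e.2])
  obtain ⟨T, hT⟩ := Intertwiner.exists_coeff_eq
    (a := fun e : {e // s e} => a e) (b := fun e : {e // t e} => a e) K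
    (fun y => ⟨{
      toFun := fun x => K x y
      map_update_add' := fun {_} x e u v => by
        exact hxadd x y e u v
      map_update_smul' := fun {_} x e c u => by
        exact hxsmul x y e c u },
      fun _ => rfl⟩)
    (fun x => ⟨{
      toFun := fun y => starRingEnd ℂ (K x y)
      map_update_add' := fun {_} y e u v => by
        exact (congrArg (starRingEnd ℂ) (hyadd x y e u v)).trans (map_add _ _ _)
      map_update_smul' := fun {_} y e c u => by
        refine (congrArg (starRingEnd ℂ) (hysmul x y e c u)).trans ?_
        rw [map_mul, Complex.conj_conj, smul_eq_mul] },
      fun _ => rfl⟩)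
    (fun g x y => by
      refine Eq.trans (congrArg C ?_) (hG g (glue (V := fun e => (a e).1.V) x y))
      funext e
      unfold glue
      split_ifs
      · rfl
      · rfl
      · exact (map_zero _).symm)
  refine ⟨T, fun x => ?_, fun T' hT' => Intertwiner.ext_coeff fun x y => ?_⟩
  · rw [hT]
    refine hC.congr _ _ fun e he => ?_
    by_cases hs : s e
    · exact dif_pos hs
    · exact (dif_neg hs).trans (dif_pos (he.resolve_left hs))
  · have := hT' (glue (V := fun e => (a e).1.V) x y)
    rw [hT]
    rwa [hl, hr] at this

end SesquilinearCoefficients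

/-! ### Duality of labels -/

section Duality

variable {G : Type*} [Group G] [TopologicalSpace G] {R : IrrepSystem.{u} G}

/-- The antiunitary equivalence from the representation `a` to the representation `a*` underlying
`IrrepSystem.dualVec`. -/
noncomputable def IrrepSystem.DualIdentification.antiunitary (φ : R.DualIdentification)
    (a : R.Label) : a.1.V ≃ₗᵢ⋆[ℂ] (R.dual a).1.V :=
  haveI := FiniteDimensional.complete ℂ a.1.V
  (show a.1.V ≃ₗᵢ⋆[ℂ] a.1.dual.V from InnerProductSpace.toDual ℂ a.1.V).trans
    (φ a).toIsometry.symm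

theorem IrrepSystem.DualIdentification.antiunitary_rep (φ : R.DualIdentification)
    (a : R.Label) (g : G) (x : a.1.V) :
    φ.antiunitary a (a.1.rep g x) = (R.dual a).1.rep g (φ.antiunitary a x) := by
  apply (φ a).toIsometry.injective
  rw [(φ a).map_rep]
  refine ((φ a).toIsometry.apply_symm_apply _).trans ?_
  refine (dualRep_riesz a.1 g x).symm.trans ?_
  exact congrArg (dualRep a.1 g) ((φ a).toIsometry.apply_symm_apply _).symm

/-- The composite of the antiunitary map `a → a*` and the Riesz map of `a*` is a unitary
equivalence of `a` with the dual of `a*`. -/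
theorem IrrepSystem.dual_dual (φ : R.DualIdentification) (a : R.Label) :
    R.dual (R.dual a) = a := by
  have := FiniteDimensional.complete ℂ (R.dual a).1.V
  refine Subtype.ext ((R.existsUnique_equiv (R.dual a).1.dual).unique
    (R.existsUnique_equiv (R.dual a).1.dual).choose_spec.1 ⟨a.2, ⟨⟨(φ.antiunitary a).trans
      (show (R.dual a).1.V ≃ₗᵢ⋆[ℂ] (R.dual a).1.dual.V from
        InnerProductSpace.toDual ℂ (R.dual a).1.V), fun g x => ?_⟩⟩⟩)
  refine Eq.trans ?_ (dualRep_riesz (R.dual a).1 g (φ.antiunitary a x)).symm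
  exact congrArg (innerSL ℂ) (φ.antiunitary_rep a g x)

/-- The passage from the vectors in a representation of the hypersurface to those in the
corresponding representation of the ambient manifold, as a map between vector spaces: it is linear
if the labels agree (`ℓ`), and conjugate-linear if they are dual to each other. -/
theorem exists_transfer (φ : R.DualIdentification) (ℓ : Prop) {a b : R.Label}
    (h : ℓ → b = a) (h' : ¬ ℓ → b = R.dual a) :
    ∃ m : a.1.V → b.1.V, (∀ u v, m (u + v) = m u + m v) ∧
      (∀ (c : ℂ) u, ℓ → m (c • u) = c • m u) ∧
      (∀ (c : ℂ) u, ¬ ℓ → m (c • u) = starRingEnd ℂ c • m u) ∧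
      (∀ g u, m (a.1.rep g u) = b.1.rep g (m u)) ∧
      ∀ u, (ℓ → (⟨b, m u⟩ : R.Vec) = ⟨a, u⟩) ∧
        (¬ ℓ → (⟨b, m u⟩ : R.Vec) = IrrepSystem.dualVec φ ⟨a, u⟩) := by
  by_cases hℓ : ℓ
  · obtain rfl := h hℓ
    exact ⟨id, fun _ _ => rfl, fun _ _ _ => rfl, fun _ _ h => absurd hℓ h, fun _ _ => rfl,
      fun _ => ⟨fun _ => rfl, fun h => absurd hℓ h⟩⟩
  · obtain rfl := h' hℓ
    exact ⟨φ.antiunitary a, map_add _, fun _ _ h => absurd h hℓ,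
      fun c u _ => LinearIsometryEquiv.map_smulₛₗ _ _ _, φ.antiunitary_rep a,
      fun _ => ⟨fun h => absurd h hℓ, fun _ => rfl⟩⟩

end Duality

/-! ### Restriction of the intertwiners -/

section Restriction

variable {N d : ℕ} {M : Type*} [TopologicalSpace M] {S : Set M}
  {Θ : Triangulation N M} {Δ : Triangulation N S}
  {G : Type*} [Group G] [TopologicalSpace G] {R : IrrepSystem.{u} G}

/-- At each vertex `v` of the hypersurface, dualization determines a unique intertwiner with the
coefficients required by the intertwiner at `ṽ`: the incidence signs of `ẽ` at `ṽ`, of `e` at `v`,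
of `ẽ` at `e`, and of `ṽ` at `v` multiply to `1`, so the required coefficients are linear in the
vectors on the edges into `v` and conjugate-linear in those on the edges out of `v`. -/
theorem existsUnique_restrict_intertwiner (φ : R.DualIdentification) (h : Θ.RestrictsTo Δ)
    (oM : Θ.Orientation (d + 1)) (oS : Δ.Orientation d)
    (κ : Θ.DualOrientation₂ d) (γ : Δ.DualOrientation₁ d)
    (F : ClosedSpinFoam R κ.skeleton) (L : Δ.Simplex d → R.Label)
    (hL : ∀ e, IncomingAtEdge h oM oS κ γ e → F.label (tilde h e) = L e)
    (hL' : ∀ e, ¬ IncomingAtEdge h oM oS κ γ e → F.label (tilde h e) = R.dual (L e))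
    (v : Δ.Simplex (d + 1)) :
    ∃! T : Intertwiner (fun e : {e : γ.skeleton.Edge // γ.skeleton.tgt e = v} => L e.1)
        (fun e : {e : γ.skeleton.Edge // γ.skeleton.src e = v} => L e.1),
      ∀ (x : ∀ e, (L e).1.V) (y : ∀ f, (F.label f).1.V),
        (∀ e : Δ.Simplex d, (IncomingAtEdge h oM oS κ γ e →
            (⟨F.label (tilde h e), y (tilde h e)⟩ : R.Vec) = ⟨L e, x e⟩) ∧
          (¬ IncomingAtEdge h oM oS κ γ e →
            (⟨F.label (tilde h e), y (tilde h e)⟩ : R.Vec) =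
              IrrepSystem.dualVec φ ⟨L e, x e⟩)) →
        (IncomingAtVertex h oM oS κ v →
          F.coeffAt (tilde h v) y = T.coeff (fun e => x e.1) (fun e => x e.1)) ∧
        (¬ IncomingAtVertex h oM oS κ v →
          F.coeffAt (tilde h v) y =
            starRingEnd ℂ (T.coeff (fun e => x e.1) (fun e => x e.1))) := by
  classical
  have htr := fun e : Δ.Simplex d =>
    exists_transfer φ (IncomingAtEdge h oM oS κ γ e) (hL e) (hL' e)
  choose m hadd hlin hconj hrep hvec using htr
  -- The correspondence of vectors, expressed through the transfer maps.
  have hcorr : ∀ (x : ∀ e, (L e).1.V) (y : ∀ f, (F.label f).1.V),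
      (∀ e : Δ.Simplex d, (IncomingAtEdge h oM oS κ γ e →
          (⟨F.label (tilde h e), y (tilde h e)⟩ : R.Vec) = ⟨L e, x e⟩) ∧
        (¬ IncomingAtEdge h oM oS κ γ e →
          (⟨F.label (tilde h e), y (tilde h e)⟩ : R.Vec) =
            IrrepSystem.dualVec φ ⟨L e, x e⟩)) ↔
      ∀ e, y (tilde h e) = m e (x e) := by
    refine fun x y => forall_congr' fun e => ⟨fun hy => ?_, fun hy => ?_⟩
    · by_cases he : IncomingAtEdge h oM oS κ γ e
      · exact eq_of_heq (Sigma.mk.inj ((hy.1 he).trans ((hvec e (x e)).1 he).symm)).2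
      · exact eq_of_heq (Sigma.mk.inj ((hy.2 he).trans ((hvec e (x e)).2 he).symm)).2
    · rw [hy]
      exact hvec e (x e)
  choose Y hY using fun x : ∀ e, (L e).1.V =>
    exists_family_extending (V := fun f => (F.label f).1.V) (tilde_injective h)
      fun e => m e (x e)
  have hdisj : ∀ f, κ.skeleton.Incoming f (tilde h v) → ¬ κ.skeleton.Outgoing f (tilde h v) :=
    fun f => not_incoming_and_outgoing κ
  have hF := Intertwiner.isSesquilinear_coeff hdisj (F.intertwiner (tilde h v))
  have hex : ∀ f, κ.skeleton.Incoming f (tilde h v) ∨ κ.skeleton.Outgoing f (tilde h v) →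
      ∃ e : Δ.Simplex d, tilde h e = f ∧ (γ.tgt e = v ∨ γ.src e = v) := fun f hf => by
    have hsub := (incoming_or_outgoing κ).1 hf
    obtain ⟨e, rfl⟩ := exists_tilde_eq h (σ := v) hsub
    exact ⟨e, rfl, ((γ.subset_iff e v).1 hsub).symm.imp Eq.symm Eq.symm⟩
  have hex' : ∀ e : Δ.Simplex d, γ.tgt e = v ∨ γ.src e = v →
      κ.skeleton.Incoming (tilde h e) (tilde h v) ∨
        κ.skeleton.Outgoing (tilde h e) (tilde h v) := fun e he =>
    (incoming_or_outgoing κ).2 ((γ.subset_iff e v).2 (he.symm.imp Eq.symm Eq.symm))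
  have hcongr : ∀ y y' : ∀ f, (F.label f).1.V, (∀ e, y (tilde h e) = y' (tilde h e)) →
      F.coeffAt (tilde h v) y = F.coeffAt (tilde h v) y' := fun y y' hyy => by
    refine hF.congr y y' fun f hf => ?_
    obtain ⟨e, rfl, -⟩ := hex f hf
    exact hyy e
  have hFG : ∀ (g : G) (y : ∀ f, (F.label f).1.V),
      F.coeffAt (tilde h v) (fun f => (F.label f).1.rep g (y f)) = F.coeffAt (tilde h v) y :=
    fun g y => Intertwiner.coeff_rep (F.intertwiner (tilde h v)) g _ _
  have hst : ∀ e, γ.tgt e = v → ¬ γ.src e = v := fun e h1 h2 => γ.src_ne_tgt e (h2.trans h1.symm)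
  have hYrep : ∀ (g : G) x, F.coeffAt (tilde h v) (Y fun e => (L e).1.rep g (x e)) =
      F.coeffAt (tilde h v) (Y x) := fun g x => by
    rw [← hFG g (Y x)]
    refine hcongr _ _ fun e => ?_
    rw [hY, hY, hrep]
  by_cases hv : IncomingAtVertex h oM oS κ v
  · have hC : IsSesquilinear (V := fun e : Δ.Simplex d => (L e).1.V)
        (fun e => γ.tgt e = v) (fun e => γ.src e = v)
        (fun x => F.coeffAt (tilde h v) (Y x)) := by
      refine hF.comp (i := tilde h) (tilde_injective h) (ℓ := IncomingAtEdge h oM oS κ γ)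
        hex hex' (fun e he => ?_) m hadd hlin hconj
        (fun x y hxy => hcongr _ _ fun e => (hY x e).trans (hxy e).symm)
      rcases he with rfl | rfl
      · have := incoming_tilde_iff_of_tgt (oM := oM) (oS := oS) h κ γ e
        tauto
      · have := incoming_tilde_iff_of_src (oM := oM) (oS := oS) h κ γ e
        have := γ.src_ne_tgt e
        tauto
    have : Finite {e // γ.src e = v} := inferInstanceAs
      (Finite {e : γ.skeleton.Edge // γ.skeleton.src e = v})
    obtain ⟨T, hT, huniq⟩ := Intertwiner.existsUnique_coeff_eq hst hC hYrep
    refine ⟨T, fun x y hxy => ⟨fun _ => ?_, fun hv' => absurd hv hv'⟩,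
      fun T' hT' => huniq T' fun x => ?_⟩
    · rw [hcorr] at hxy
      exact (hcongr _ _ fun e => (hxy e).trans (hY x e).symm).trans (hT x).symm
    · exact ((hT' x (Y x) ((hcorr _ _).2 (hY x))).1 hv).symm
  · have hC : IsSesquilinear (V := fun e : Δ.Simplex d => (L e).1.V)
        (fun e => γ.src e = v) (fun e => γ.tgt e = v)
        (fun x => F.coeffAt (tilde h v) (Y x)) := by
      refine hF.comp (i := tilde h) (tilde_injective h) (ℓ := IncomingAtEdge h oM oS κ γ)
        (fun f hf => ?_) (fun e he => hex' e he.symm) (fun e he => ?_) m hadd hlin hconj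
        (fun x y hxy => hcongr _ _ fun e => (hY x e).trans (hxy e).symm)
      · obtain ⟨e, h1, h2⟩ := hex f hf
        exact ⟨e, h1, h2.symm⟩
      rcases he with rfl | rfl
      · have := incoming_tilde_iff_of_src (oM := oM) (oS := oS) h κ γ e
        tauto
      · have := incoming_tilde_iff_of_tgt (oM := oM) (oS := oS) h κ γ e
        have := γ.src_ne_tgt e
        tauto
    have : Finite {e // γ.src e = v} := inferInstanceAs
      (Finite {e : γ.skeleton.Edge // γ.skeleton.src e = v})
    obtain ⟨T, hT, huniq⟩ := Intertwiner.existsUnique_coeff_eq hst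
      (hC.conj fun e h1 h2 => hst e h2 h1) (fun g x => congrArg _ (hYrep g x))
    refine ⟨T, fun x y hxy => ⟨fun hv' => absurd hv' hv, fun _ => ?_⟩,
      fun T' hT' => huniq T' fun x => ?_⟩
    · rw [hcorr] at hxy
      refine (hcongr _ _ fun e => (hxy e).trans (hY x e).symm).trans ?_
      exact (Complex.conj_conj _).symm.trans (congrArg (starRingEnd ℂ) (hT x).symm)
    · have := (hT' x (Y x) ((hcorr _ _).2 (hY x))).2 hv
      exact (Complex.conj_conj _).symm.trans (congrArg (starRingEnd ℂ) this.symm)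

end Restriction

end SpinFoam

theorem mainTheorem1 {G : Type*} [Group G] [TopologicalSpace G] [IsTopologicalGroup G]
    [CompactSpace G]
    (R : SpinFoam.IrrepSystem.{u} G) (φ : R.DualIdentification)
    {d N : ℕ}
    {M : Type*} [TopologicalSpace M] [ChartedSpace (EuclideanSpace ℝ (Fin (d + 1))) M]
    (S : Set M) [ChartedSpace (EuclideanSpace ℝ (Fin d)) S]
    (Θ : SpinFoam.Triangulation N M) (Δ : SpinFoam.Triangulation N S) (h : Θ.RestrictsTo Δ)
    (oM : Θ.Orientation (d + 1)) (oS : Δ.Orientation d)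
    (κ : Θ.DualOrientation₂ d) (γ : Δ.DualOrientation₁ d)
    (F : SpinFoam.ClosedSpinFoam R κ.skeleton) :
    ∃! Ψ : SpinFoam.SpinNetwork R γ.skeleton,
      SpinFoam.IsRestriction φ h oM oS κ γ F Ψ := by
  classical
  let L : Δ.Simplex d → R.Label := fun e =>
    if SpinFoam.IncomingAtEdge h oM oS κ γ e then F.label (SpinFoam.tilde h e)
    else R.dual (F.label (SpinFoam.tilde h e))
  have hL : ∀ e, SpinFoam.IncomingAtEdge h oM oS κ γ e →
      F.label (SpinFoam.tilde h e) = L e := fun e he => (if_pos he).symm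
  have hL' : ∀ e, ¬ SpinFoam.IncomingAtEdge h oM oS κ γ e →
      F.label (SpinFoam.tilde h e) = R.dual (L e) := fun e he => by
    rw [show L e = R.dual (F.label (SpinFoam.tilde h e)) from if_neg he, R.dual_dual φ]
  choose T hT huniq using
    SpinFoam.existsUnique_restrict_intertwiner φ h oM oS κ γ F L hL hL'
  refine ⟨⟨L, T⟩, ⟨hL, hL', fun v hv x y hxy => (hT v x y hxy).1 hv,
    fun v hv x y hxy => (hT v x y hxy).2 hv⟩, ?_⟩
  rintro ⟨L', T'⟩ ⟨h1, h2, h3, h4⟩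
  obtain rfl : L' = L := funext fun e => by
    by_cases he : SpinFoam.IncomingAtEdge h oM oS κ γ e
    · exact (h1 e he).symm.trans (hL e he)
    · rw [← R.dual_dual φ (L' e), ← R.dual_dual φ (L e), ← hL' e he]
      exact congrArg R.dual (h2 e he).symm
  refine congrArg (SpinFoam.SpinNetwork.mk _) (funext fun v => ?_)
  exact huniq v (T' v) fun x y hxy => ⟨fun hv => h3 v hv x y hxy, fun hv => h4 v hv x y hxy⟩
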